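/- Let $D$ be a nonnegative integer and let $\mathcal L$ be a real Lie algebra of anti-Hermitian complex $D\times D$ matrices, i.e. a real linear subspace of $\{C\in\mathbb C^{D\times D}: C^\dagger=-C\}$ that is closed under the commutator $[X,Y]=XY-YX$ (for instance, the dynamical Lie algebra generated by $\{iH_m\}$ for Hermitian matrices $H_m$). Let $\|A\|_F=\sqrt{\operatorname{tr}A^\dagger A}$ be the Frobenius norm and let $e^{\mathcal L}=\{e^C : C\in\mathcal L\}$, a set of unitary matrices. Then for all $U_1,U_2\in e^{\mathcal L}$ the minimum $$d(U_1,U_2)=\min\{\|C\|_F : C\in\mathcal L,\ e^{C}=U_1U_2^{-1}\}$$ exists, and $d$ is a metric on $e^{\mathcal L}$. That is, for all $U_1,U_2,U_3\in e^{\mathcal L}$: (i) $d(U_1,U_2)=0$ if and only if $U_1=U_2$; (ii) if $U_1\neq U_2$, then $d(U_1,U_2)>0$; (iii) $d(U_1,U_2)=d(U_2,U_1)$; (iv) $d(U_1,U_2)\le d(U_1,U_3)+d(U_3,U_2)$. -/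

import Mathlib

-- The Lie bracket of matrices is the commutator `A * B - B * A`.
attribute [local instance] LieRing.ofAssociativeRing

noncomputable section

namespace UnitaryMetric

variable {n : Type*} [Fintype n] [DecidableEq n]

/-- The Frobenius norm `‖A‖_F = √(tr (A† A))` of a complex square matrix
(the trace is a nonnegative real number). -/
def frobNorm (A : Matrix n n ℂ) : ℝ :=
  Real.sqrt (Matrix.trace (A.conjTranspose * A)).re

/-- The set `e^L` of unitary matrices that are exponentials of elements of the real
matrix Lie algebra `L`. -/
def expSet (L : LieSubalgebra ℝ (Matrix n n ℂ)) : Set (Matrix.unitaryGroup n ℂ) :=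
  {U | ∃ C ∈ L, NormedSpace.exp C = (U : Matrix n n ℂ)}

/-- The set of norms `{‖C‖_F : C ∈ L, e^C = U₁ U₂⁻¹}`. -/
def generatorNorms (L : LieSubalgebra ℝ (Matrix n n ℂ)) (U₁ U₂ : Matrix.unitaryGroup n ℂ) :
    Set ℝ :=
  {r | ∃ C ∈ L, NormedSpace.exp C = ((U₁ * U₂⁻¹ : Matrix.unitaryGroup n ℂ) : Matrix n n ℂ) ∧
    frobNorm C = r}

/-- The function `d(U₁, U₂)`: the infimum of `generatorNorms L U₁ U₂`. That the infimum is a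
minimum for `U₁, U₂ ∈ e^L` is part of the main theorem. -/
def unitaryDist (L : LieSubalgebra ℝ (Matrix n n ℂ)) (U₁ U₂ : Matrix.unitaryGroup n ℂ) : ℝ :=
  sInf (generatorNorms L U₁ U₂)

end UnitaryMetric

end

/-! ### Derivative of the exponential and conjugation inside a Lie subalgebra. -/

section BanachAlgebra

open Filter Topology NormedSpace

variable {𝔸 : Type*} [NormedRing 𝔸] [NormedAlgebra ℝ 𝔸] [CompleteSpace 𝔸]

/-! Everything rests on one fact: for `a, b ∈ L` some `c ∈ L` has `exp c = exp a * exp b` and `‖c‖ ≤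
‖a‖ + ‖b‖` (`exists_exp_eq_exp_mul_exp_norm_le`). As `e^L` may fail to be closed in the unitary
group, compactness is used only for bounded subsets of `L`.

Cut `exp a * exp b` into many small factors `exp (f i)` and minimize the energy `∑ ‖f i‖ ^ 2 / w i`
among tuples of small elements of `L` with the same product. A minimizer exists and lies off the
boundary. Moving `exp (s • X)` between two neighbouring factors keeps the product
(`exists_curve_exp_eq_mul_exp`), and the Gauss lemma computes the first variation, which forces all
`(w i)⁻¹ • f i` to coincide: a broken geodesic of least energy is unbroken. The product is then a
single exponential, and the energy bound gives the norm bound.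

The minimum exists because the logarithms in `L` of a given unitary form a closed set in a
finite-dimensional space. -/

theorem contDiff_exp_real : ContDiff ℝ 2 (exp : 𝔸 → 𝔸) :=
  contDiff_iff_contDiffAt.2 fun x => (exp_analytic (𝕂 := ℝ) x).contDiffAt

theorem continuous_exp_real : Continuous (exp : 𝔸 → 𝔸) := contDiff_exp_real.continuous

theorem hasFDerivAt_exp_real (a : 𝔸) : HasFDerivAt (exp : 𝔸 → 𝔸) (fderiv ℝ exp a) a :=
  (contDiff_exp_real.differentiable (by norm_num) a).hasFDerivAt

theorem exp_neg_mul_exp_self (a : 𝔸) : exp (-a) * exp a = 1 := by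
  let := NormedAlgebra.restrictScalars ℚ ℝ 𝔸
  rw [← exp_add_of_commute (Commute.neg_left (Commute.refl a)), neg_add_cancel, exp_zero]

theorem exp_mul_exp_neg_self (a : 𝔸) : exp a * exp (-a) = 1 := by
  simpa using exp_neg_mul_exp_self (-a)

theorem exp_smul_mul_exp_smul (s t : ℝ) (a : 𝔸) :
    exp (s • a) * exp (t • a) = exp ((s + t) • a) := by
  let := NormedAlgebra.restrictScalars ℚ ℝ 𝔸
  rw [add_smul, exp_add_of_commute]
  exact ((Commute.refl a).smul_left s).smul_right t

theorem hasDerivAt_exp_neg_smul (a : 𝔸) (t : ℝ) :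
    HasDerivAt (fun u : ℝ => exp (-(u • a))) (-(exp (-(t • a)) * a)) t := by
  simpa using hasDerivAt_exp_smul_const (𝕂 := ℝ) (-a) t

theorem exp_neg_mul_exp_sub_one (a b : 𝔸) :
    exp (-a) * exp b - 1 = ∫ t in (0 : ℝ)..1, exp (-(t • a)) * (b - a) * exp (t • b) := by
  have hd : ∀ t : ℝ, HasDerivAt (fun t : ℝ => exp (-(t • a)) * exp (t • b))
      (exp (-(t • a)) * (b - a) * exp (t • b)) t := fun t => by
    refine ((hasDerivAt_exp_neg_smul a t).mul
      (hasDerivAt_exp_smul_const' (𝕂 := ℝ) b t)).congr_deriv ?_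
    noncomm_ring
  have hc : Continuous fun t : ℝ => exp (-(t • a)) * (b - a) * exp (t • b) :=
    ((continuous_exp_real.comp (by fun_prop)).mul continuous_const).mul
      (continuous_exp_real.comp (by fun_prop))
  rw [intervalIntegral.integral_eq_sub_of_hasDerivAt (fun t _ => hd t)
    (hc.intervalIntegrable _ _)]
  simp

/-- Duhamel's formula for the derivative of the exponential. -/
theorem exp_neg_mul_fderiv_exp (a y : 𝔸) :
    exp (-a) * fderiv ℝ exp a y =
      ∫ t in (0 : ℝ)..1, exp (-(t • a)) * y * exp (t • a) := by
  set I : ℝ → 𝔸 := fun s => ∫ t in (0 : ℝ)..1, exp (-(t • a)) * y * exp (t • (a + s • y)) with hI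
  have hIc : Continuous I := by
    refine intervalIntegral.continuous_parametric_intervalIntegral_of_continuous' ?_ _ _
    exact ((continuous_exp_real.comp (by fun_prop)).mul continuous_const).mul
      (continuous_exp_real.comp (by fun_prop))
  -- The difference quotient at `0` is thus exactly `I s`, and continuity of `I` gives the
  -- derivative.
  have key : ∀ s : ℝ, exp (-a) * exp (a + s • y) - 1 = s • I s := fun s => by
    rw [exp_neg_mul_exp_sub_one, hI, ← intervalIntegral.integral_smul]
    simp
  have h1 : HasDerivAt (fun s : ℝ => exp (-a) * exp (a + s • y))
      (exp (-a) * fderiv ℝ exp a y) 0 := by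
    have hl : HasDerivAt (fun s : ℝ => a + s • y) y 0 := by
      simpa using ((hasDerivAt_id (0 : ℝ)).smul_const y).const_add a
    have hf : HasFDerivAt (exp : 𝔸 → 𝔸) (fderiv ℝ exp a) (a + (0 : ℝ) • y) := by
      simpa using hasFDerivAt_exp_real a
    exact (hf.comp_hasDerivAt (0 : ℝ) hl).const_mul _
  have h2 : HasDerivAt (fun s : ℝ => exp (-a) * exp (a + s • y)) (I 0) 0 := by
    rw [hasDerivAt_iff_tendsto_slope]
    refine (hIc.continuousAt.tendsto.mono_left nhdsWithin_le_nhds).congr' ?_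
    filter_upwards [self_mem_nhdsWithin] with s hs
    have hs' : s ≠ 0 := hs
    have h0 : exp (-a) * exp (a + (0 : ℝ) • y) = 1 := by simpa using exp_neg_mul_exp_self a
    rw [slope_def_module, h0, key, sub_zero, smul_smul, inv_mul_cancel₀ hs', one_smul]
  rw [h1.unique h2, hI]
  simp

theorem exists_hasDerivAt_clm_apply {E : Type*} [NormedAddCommGroup E] [NormedSpace ℝ E]
    [CompleteSpace E] (D : E →L[ℝ] E) (x : E) :
    ∃ v : ℝ → E, v 0 = x ∧ ∀ t, HasDerivAt v (D (v t)) t :=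
  ⟨fun t => (exp (t • D) : E →L[ℝ] E) x, by simp, fun t => by
    simpa using (hasDerivAt_exp_smul_const' (𝕂 := ℝ) D t).clm_apply (hasDerivAt_const t x)⟩

/-- The conjugates `exp (-(t • a)) * y * exp (t • a)` solve `v' = v * a - a * v`, a linear equation
that can be solved within `L` itself because `L` is closed under commutators. -/
theorem exp_neg_mul_mul_exp_mem [FiniteDimensional ℝ 𝔸] {L : Submodule ℝ 𝔸}
    (hL : ∀ x ∈ L, ∀ y ∈ L, x * y - y * x ∈ L) {a y : 𝔸} (ha : a ∈ L) (hy : y ∈ L) :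
    exp (-a) * y * exp a ∈ L := by
  let D₀ : L →ₗ[ℝ] L :=
    { toFun := fun v => ⟨v * a - a * v, hL _ v.2 _ ha⟩
      map_add' := fun v w => Subtype.ext (by simp; noncomm_ring)
      map_smul' := fun r v => Subtype.ext (by simp [smul_sub]) }
  let D : L →L[ℝ] L := LinearMap.toContinuousLinearMap D₀
  obtain ⟨w, hw0, hw⟩ := exists_hasDerivAt_clm_apply D ⟨y, hy⟩
  let v : ℝ → 𝔸 := fun t => w t
  have hv : ∀ t : ℝ, HasDerivAt v (v t * a - a * v t) t := fun t => by
    exact L.subtypeL.hasFDerivAt.comp_hasDerivAt t (hw t)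
  -- Undoing the conjugation gives a constant, which identifies the solution in `L` with the
  -- conjugate.
  let g : ℝ → 𝔸 := fun t => exp (t • a) * v t * exp (-(t • a))
  have hg : ∀ t : ℝ, HasDerivAt g 0 t := fun t => by
    have hc : exp (-(t • a)) * a = a * exp (-(t • a)) := by
      have := Commute.exp_left (𝔸 := 𝔸) (((Commute.refl a).smul_left t).neg_left)
      exact this.eq
    refine (((hasDerivAt_exp_smul_const (𝕂 := ℝ) a t).mul (hv t)).mul
      (hasDerivAt_exp_neg_smul a t)).congr_deriv ?_
    simp only [Pi.mul_apply]
    rw [hc]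
    noncomm_ring
  have hconst : g 1 = g 0 :=
    is_const_of_deriv_eq_zero (fun t => (hg t).differentiableAt) (fun t => (hg t).deriv) 1 0
  have h0 : g 0 = y := by simp [g, v, hw0]
  have h1 : g 1 = exp a * v 1 * exp (-a) := by simp [g]
  have : exp (-a) * y * exp a = v 1 := by
    rw [← h0, ← hconst, h1]
    calc exp (-a) * (exp a * v 1 * exp (-a)) * exp a
        = (exp (-a) * exp a) * v 1 * (exp (-a) * exp a) := by noncomm_ring
      _ = v 1 := by rw [exp_neg_mul_exp_self]; simp
  rw [this]
  exact Subtype.coe_prop _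

end BanachAlgebra

/-! ### Local right translation inside `exp L` and the Gauss lemma. -/

section LieSubspace

open Filter Topology NormedSpace

variable {𝔸 : Type*} [NormedRing 𝔸] [NormedAlgebra ℝ 𝔸] [CompleteSpace 𝔸]

/-- The derivative of `exp` on a subspace `L`, translated back to the identity on the left and
projected to `L` along `P`. -/
noncomputable def leftLogDeriv (L : Submodule ℝ 𝔸) (P : 𝔸 →L[ℝ] L) (a : L) : L →L[ℝ] L :=
  P ∘L (ContinuousLinearMap.mul ℝ 𝔸 (exp (-(a : 𝔸)))) ∘L (fderiv ℝ exp (a : 𝔸)) ∘L L.subtypeL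

theorem contDiff_leftLogDeriv (L : Submodule ℝ 𝔸) (P : 𝔸 →L[ℝ] L) :
    ContDiff ℝ 1 (leftLogDeriv L P) := by
  have h1 : ContDiff ℝ 1 fun a : L => ContinuousLinearMap.mul ℝ 𝔸 (exp (-(a : 𝔸))) :=
    (ContinuousLinearMap.mul ℝ 𝔸).contDiff.comp
      ((contDiff_exp_real.of_le (by norm_num)).comp L.subtypeL.contDiff.neg)
  have h2 : ContDiff ℝ 1 fun a : L => fderiv ℝ (exp : 𝔸 → 𝔸) (a : 𝔸) :=
    (contDiff_exp_real.fderiv_right (m := 1) (by norm_num)).comp L.subtypeL.contDiff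
  exact contDiff_const.clm_comp (h1.clm_comp (h2.clm_comp contDiff_const))

theorem leftLogDeriv_zero {L : Submodule ℝ 𝔸} {P : 𝔸 →L[ℝ] L}
    (hP : ∀ x : L, P x = x) :
    leftLogDeriv L P 0 = ContinuousLinearMap.id ℝ L := by
  ext y
  have h : fderiv ℝ (exp : 𝔸 → 𝔸) 0 = 1 := (hasFDerivAt_exp_zero (𝕂 := ℝ)).fderiv
  simp [leftLogDeriv, h, hP]

/-- By Duhamel's formula the translated derivative is an integral of conjugates lying in `L`, so the
projection `P` changes nothing. -/
theorem coe_leftLogDeriv_apply [FiniteDimensional ℝ 𝔸] {L : Submodule ℝ 𝔸}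
    (hL : ∀ x ∈ L, ∀ y ∈ L, x * y - y * x ∈ L) {P : 𝔸 →L[ℝ] L}
    (hP : ∀ x : L, P x = x)
    (a y : L) :
    (leftLogDeriv L P a y : 𝔸) = exp (-(a : 𝔸)) * fderiv ℝ exp (a : 𝔸) y := by
  have hc : Continuous fun t : ℝ => exp (-(t • (a : 𝔸))) * (y : 𝔸) * exp (t • (a : 𝔸)) :=
    ((continuous_exp_real.comp (by fun_prop)).mul continuous_const).mul
      (continuous_exp_real.comp (by fun_prop))
  have h := (L.subtypeL ∘L P).intervalIntegral_comp_comm (μ := MeasureTheory.volume)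
    (hc.intervalIntegrable 0 1)
  simp only [leftLogDeriv, ContinuousLinearMap.comp_apply, ContinuousLinearMap.mul_apply',
    Submodule.subtypeL_apply] at h ⊢
  rw [exp_neg_mul_fderiv_exp, ← h]
  refine intervalIntegral.integral_congr fun t _ => ?_
  have hm : exp (-(t • (a : 𝔸))) * (y : 𝔸) * exp (t • (a : 𝔸)) ∈ L :=
    exp_neg_mul_mul_exp_mem hL (L.smul_mem t a.2) y.2
  exact congrArg Subtype.val (hP ⟨_, hm⟩)

/-- Near an element of `L` where the exponential is nonsingular, right translates of `exp a` by a
one-parameter group of `L` stay in `exp L`. -/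
theorem exists_curve_exp_eq_mul_exp [FiniteDimensional ℝ 𝔸] {L : Submodule ℝ 𝔸}
    (hL : ∀ x ∈ L, ∀ y ∈ L, x * y - y * x ∈ L) {P : 𝔸 →L[ℝ] L}
    (hP : ∀ x : L, P x = x)
    {a : L} (ha : (leftLogDeriv L P a).IsInvertible) (x : L) :
    ∃ c : ℝ → L, ∃ v : L, c 0 = a ∧ HasDerivAt c v 0 ∧
      exp (-(a : 𝔸)) * fderiv ℝ exp (a : 𝔸) v = x ∧
      ∀ᶠ s in 𝓝 (0 : ℝ), exp (c s : 𝔸) = exp (a : 𝔸) * exp (s • (x : 𝔸)) := by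
  -- An integral curve of this field satisfies `(exp c)' = exp c * x`, the equation solved by `exp a
  -- * exp (s • x)`.
  let X : L → L := fun b => (leftLogDeriv L P b).inverse x
  have hX : ContDiffAt ℝ 1 X a :=
    (ha.contDiffAt_map_inverse.comp a (contDiff_leftLogDeriv L P).contDiffAt).clm_apply
      contDiffAt_const
  obtain ⟨c, hc0, ε, hε, hc⟩ :=
    hX.exists_forall_mem_closedBall_exists_eq_forall_mem_Ioo_hasDerivAt₀ 0
  have hinv : ∀ᶠ b in 𝓝 a, (leftLogDeriv L P b).IsInvertible := by
    obtain ⟨e, he⟩ := ha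
    have := (contDiff_leftLogDeriv L P).continuous.continuousAt (x := a)
    exact this.eventually (he ▸ e.nhds)
  have hXeq : ∀ b : L, (leftLogDeriv L P b).IsInvertible →
      exp (-(b : 𝔸)) * fderiv ℝ exp (b : 𝔸) (X b) = x := fun b hb => by
    rw [← coe_leftLogDeriv_apply hL hP]
    congr 1
    obtain ⟨e, he⟩ := hb
    simp [X, ← he]
  have hcd0 : HasDerivAt c (X a) 0 := by
    have := hc 0 (by constructor <;> linarith)
    rwa [hc0] at this
  have hct : Tendsto c (𝓝 0) (𝓝 a) := by
    have := hcd0.continuousAt.tendsto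
    rwa [hc0] at this
  refine ⟨c, X a, hc0, hcd0, hXeq a ha, ?_⟩
  obtain ⟨δ, hδ, hball⟩ := Metric.eventually_nhds_iff_ball.1
    ((hct.eventually hinv).and (Ioo_mem_nhds (show 0 - ε < 0 by linarith)
      (show 0 < 0 + ε by linarith)))
  let g : ℝ → 𝔸 := fun s => exp (c s : 𝔸) * exp (-(s • (x : 𝔸)))
  have hg : ∀ s ∈ Metric.ball (0 : ℝ) δ, HasDerivAt g 0 s := fun s hs => by
    obtain ⟨h1, h2⟩ := hball s hs
    have hd : HasDerivAt (fun s => exp (c s : 𝔸)) (exp (c s : 𝔸) * x) s := by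
      refine ((hasFDerivAt_exp_real (c s : 𝔸)).comp_hasDerivAt s
        (L.subtypeL.hasFDerivAt.comp_hasDerivAt s (hc s h2))).congr_deriv ?_
      rw [← hXeq (c s) h1, ← mul_assoc, exp_mul_exp_neg_self, one_mul]
      rfl
    refine (hd.mul (hasDerivAt_exp_neg_smul (x : 𝔸) s)).congr_deriv ?_
    have hcomm : exp (-(s • (x : 𝔸))) * x = x * exp (-(s • (x : 𝔸))) :=
      (Commute.exp_left (((Commute.refl (x : 𝔸)).smul_left s).neg_left)).eq
    rw [hcomm]
    noncomm_ring
  filter_upwards [Metric.ball_mem_nhds (0 : ℝ) hδ] with s hs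
  have hgs : g s = g 0 :=
    (convex_ball (0 : ℝ) δ).is_const_of_fderivWithin_eq_zero (𝕜 := ℝ)
      (fun r hr => (hg r hr).differentiableAt.differentiableWithinAt)
      (fun r hr => by
        rw [fderivWithin_of_isOpen Metric.isOpen_ball hr]
        have := (hg r hr).hasFDerivAt.fderiv
        simpa using this) hs (Metric.mem_ball_self hδ)
  have hg0 : g 0 = exp (a : 𝔸) := by simp [g, hc0]
  rw [← hg0, ← hgs]
  simp only [g]
  rw [mul_assoc, exp_neg_mul_exp_self, mul_one]

theorem exists_pos_forall_norm_lt_exists_curve [FiniteDimensional ℝ 𝔸] {L : Submodule ℝ 𝔸}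
    (hL : ∀ x ∈ L, ∀ y ∈ L, x * y - y * x ∈ L) :
    ∃ ε > 0, ∀ a : L, ‖a‖ < ε → ∀ x : L, ∃ c : ℝ → L, ∃ v : L, c 0 = a ∧ HasDerivAt c v 0 ∧
      exp (-(a : 𝔸)) * fderiv ℝ exp (a : 𝔸) v = x ∧
      ∀ᶠ s in 𝓝 (0 : ℝ), exp (c s : 𝔸) = exp (a : 𝔸) * exp (s • (x : 𝔸)) := by
  obtain ⟨P, hP⟩ := Submodule.ClosedComplemented.of_finiteDimensional_quotient
    L.closed_of_finiteDimensional
  have hinv : ∀ᶠ b in 𝓝 (0 : L), (leftLogDeriv L P b).IsInvertible := by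
    have := (contDiff_leftLogDeriv L P).continuous.continuousAt (x := 0)
    refine this.eventually ?_
    rw [leftLogDeriv_zero hP]
    exact (ContinuousLinearEquiv.refl ℝ L).nhds
  obtain ⟨ε, hε, h⟩ := Metric.eventually_nhds_iff.1 hinv
  refine ⟨ε, hε, fun a ha x => exists_curve_exp_eq_mul_exp hL hP (h ?_) x⟩
  simpa using ha

/-- The Gauss lemma for a trace form. -/
theorem traceForm_mul_eq_of_exp_neg_mul_fderiv_exp_eq {τ : 𝔸 →L[ℝ] ℝ}
    (hτ : ∀ x y, τ (x * y) = τ (y * x)) {a v x : 𝔸}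
    (h : exp (-a) * fderiv ℝ exp a v = x) : τ (a * v) = τ (a * x) := by
  rw [← h, exp_neg_mul_fderiv_exp]
  have hc : Continuous fun t : ℝ => exp (-(t • a)) * v * exp (t • a) :=
    ((continuous_exp_real.comp (by fun_prop)).mul continuous_const).mul
      (continuous_exp_real.comp (by fun_prop))
  have := (τ ∘L ContinuousLinearMap.mul ℝ 𝔸 a).intervalIntegral_comp_comm
    (μ := MeasureTheory.volume) (hc.intervalIntegrable 0 1)
  simp only [ContinuousLinearMap.comp_apply, ContinuousLinearMap.mul_apply'] at this
  rw [← this]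
  -- Cyclicity of `τ` moves the last factor to the front, where it commutes with `a` and cancels.
  have hconst : ∀ t : ℝ, τ (a * (exp (-(t • a)) * v * exp (t • a))) = τ (a * v) := fun t => by
    have hcomm : exp (t • a) * a = a * exp (t • a) :=
      (Commute.exp_left ((Commute.refl a).smul_left t)).eq
    calc τ (a * (exp (-(t • a)) * v * exp (t • a)))
        = τ ((a * exp (-(t • a)) * v) * exp (t • a)) := by noncomm_ring
      _ = τ (exp (t • a) * (a * exp (-(t • a)) * v)) := hτ _ _
      _ = τ ((exp (t • a) * a) * exp (-(t • a)) * v) := by noncomm_ring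
      _ = τ (a * (exp (t • a) * exp (-(t • a))) * v) := by rw [hcomm]; noncomm_ring
      _ = τ (a * v) := by rw [exp_mul_exp_neg_self, mul_one]
  simp [hconst]

end LieSubspace

/-! ### Ordered products of exponentials. -/

section ExpProd

open Filter Topology NormedSpace

variable {𝔸 : Type*} [NormedRing 𝔸]

/-- The ordered product `exp (f 0) * exp (f 1) * ⋯ * exp (f (k - 1))`. -/
noncomputable def expProd (f : ℕ → 𝔸) : ℕ → 𝔸
  | 0 => 1
  | k + 1 => expProd f k * exp (f k)

theorem expProd_congr {f g : ℕ → 𝔸} {k : ℕ} (h : ∀ i < k, f i = g i) :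
    expProd f k = expProd g k := by
  induction k with
  | zero => rfl
  | succ k ih => rw [expProd, expProd, ih fun i hi => h i (by omega), h k (by omega)]

theorem expProd_eq_of_pair {f g : ℕ → 𝔸} {i k : ℕ} (hik : i + 1 < k)
    (h : ∀ j, j ≠ i → j ≠ i + 1 → f j = g j)
    (hpair : exp (f i) * exp (f (i + 1)) = exp (g i) * exp (g (i + 1))) :
    expProd f k = expProd g k := by
  induction k, hik using Nat.le_induction with
  | base =>
    rw [expProd, expProd, expProd, expProd, mul_assoc, mul_assoc, hpair,
      expProd_congr fun j hj => h j (by omega) (by omega)]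
  | succ k hk ih => rw [expProd, ih, h k (by omega) (by omega), ← expProd]

theorem continuous_expProd [NormedAlgebra ℝ 𝔸] [CompleteSpace 𝔸] (k : ℕ) :
    Continuous fun f : ℕ → 𝔸 => expProd f k := by
  induction k with
  | zero => exact continuous_const
  | succ k ih => exact ih.mul (continuous_exp_real.comp (continuous_apply k))

theorem expProd_smul [NormedAlgebra ℝ 𝔸] [CompleteSpace 𝔸] {f : ℕ → 𝔸} {w : ℕ → ℝ} {C : 𝔸} {k : ℕ}
    (h : ∀ i < k, f i = w i • C) : expProd f k = exp ((∑ i ∈ Finset.range k, w i) • C) := by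
  induction k with
  | zero => simp [expProd]
  | succ k ih =>
    rw [expProd, ih fun i hi => h i (by omega), h k (by omega), exp_smul_mul_exp_smul,
      Finset.sum_range_succ]

end ExpProd

/-! ### Minimizing the discrete energy. -/

section Minimization

open Filter Topology NormedSpace

variable {𝔸 : Type*} [NormedRing 𝔸] [NormedAlgebra ℝ 𝔸]

theorem hasDerivAt_norm_sq_of_traceForm {L : Submodule ℝ 𝔸} {τ : 𝔸 →L[ℝ] ℝ}
    (hτ : ∀ x y, τ (x * y) = τ (y * x)) (hn : ∀ x ∈ L, ‖x‖ ^ 2 = -τ (x * x))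
    {c : ℝ → L} {v : L} {t : ℝ} (hc : HasDerivAt c v t) :
    HasDerivAt (fun s => ‖c s‖ ^ 2) (-2 * τ (c t * v)) t := by
  have h1 : (fun s => ‖c s‖ ^ 2) = fun s => -τ ((c s : 𝔸) * (c s : 𝔸)) :=
    funext fun s => hn _ (c s).2
  have h2 : HasDerivAt (fun s => (c s : 𝔸)) (v : 𝔸) t :=
    L.subtypeL.hasFDerivAt.comp_hasDerivAt t hc
  rw [h1]
  refine ((τ.hasFDerivAt.comp_hasDerivAt t (h2.mul h2)).neg).congr_deriv ?_
  rw [map_add, hτ v (c t)]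
  ring

theorem exists_isMinOn_energy [FiniteDimensional ℝ 𝔸] (L : Submodule ℝ 𝔸)
    (w : ℕ → ℝ) (ε : ℝ) (k : ℕ) (f₀ : ℕ → L)
    (h₀ : ∀ i, ‖f₀ i‖ ≤ ε) :
    ∃ f : ℕ → L, (∀ i, ‖f i‖ ≤ ε) ∧
      expProd (fun i => (f i : 𝔸)) k = expProd (fun i => (f₀ i : 𝔸)) k ∧
      ∀ g : ℕ → L, (∀ i, ‖g i‖ ≤ ε) →
        expProd (fun i => (g i : 𝔸)) k = expProd (fun i => (f₀ i : 𝔸)) k →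
        ∑ i ∈ Finset.range k, ‖f i‖ ^ 2 / w i ≤ ∑ i ∈ Finset.range k, ‖g i‖ ^ 2 / w i := by
  have := FiniteDimensional.complete ℝ 𝔸
  have : ProperSpace L := FiniteDimensional.proper ℝ L
  -- Bounding all entries, not only the first `k`, makes `K` compact by Tychonoff.
  let K : Set (ℕ → L) := {f | ∀ i, f i ∈ Metric.closedBall 0 ε} ∩
    {f | expProd (fun i => (f i : 𝔸)) k = expProd (fun i => (f₀ i : 𝔸)) k}
  have hK : IsCompact K := by
    refine IsCompact.inter_right (isCompact_pi_infinite fun _ => isCompact_closedBall _ _) ?_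
    refine isClosed_eq ?_ continuous_const
    exact (continuous_expProd k).comp (by fun_prop)
  have hcont : Continuous fun f : ℕ → L => ∑ i ∈ Finset.range k, ‖f i‖ ^ 2 / w i := by fun_prop
  obtain ⟨f, hf, hmin⟩ := hK.exists_isMinOn ⟨f₀, fun i => by simpa using h₀ i, rfl⟩
    hcont.continuousOn
  exact ⟨f, fun i => by simpa using hf.1 i, hf.2, fun g hg hg' =>
    hmin ⟨fun i => by simpa using hg i, hg'⟩⟩

/-- A product of sufficiently small exponentials from `L` is a single exponential, of no greater
energy. -/
theorem exists_exp_eq_expProd [FiniteDimensional ℝ 𝔸] {L : Submodule ℝ 𝔸}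
    (hL : ∀ x ∈ L, ∀ y ∈ L, x * y - y * x ∈ L) {τ : 𝔸 →L[ℝ] ℝ}
    (hτ : ∀ x y, τ (x * y) = τ (y * x)) (hn : ∀ x ∈ L, ‖x‖ ^ 2 = -τ (x * x)) :
    ∃ ε > 0, ∀ (k : ℕ) (w : ℕ → ℝ) (f₀ : ℕ → L), (∀ i, 0 < w i) → (∀ i, ‖f₀ i‖ ≤ ε) →
      (∀ i, w i * ∑ j ∈ Finset.range k, ‖f₀ j‖ ^ 2 / w j < ε ^ 2) →
      ∃ C : L, exp ((∑ i ∈ Finset.range k, w i) • (C : 𝔸)) = expProd (fun i => (f₀ i : 𝔸)) k ∧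
        (∑ i ∈ Finset.range k, w i) * ‖C‖ ^ 2 ≤ ∑ i ∈ Finset.range k, ‖f₀ i‖ ^ 2 / w i := by
  have := FiniteDimensional.complete ℝ 𝔸
  obtain ⟨ε, hε, hcurve⟩ := exists_pos_forall_norm_lt_exists_curve hL
  refine ⟨ε, hε, fun k w f₀ hw h₀ hE => ?_⟩
  obtain ⟨f, hf, hfp, hmin⟩ := exists_isMinOn_energy L w ε k f₀ h₀
  have hfE := hmin f₀ h₀ rfl
  -- The energy bound keeps the minimizer off the boundary, so small variations in both directions
  -- are admissible.
  have hlt : ∀ i < k, ‖f i‖ < ε := fun i hi => by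
    have h1 : ‖f i‖ ^ 2 / w i ≤ ∑ j ∈ Finset.range k, ‖f₀ j‖ ^ 2 / w j :=
      (Finset.single_le_sum (f := fun j => ‖f j‖ ^ 2 / w j)
        (fun j _ => div_nonneg (sq_nonneg _) (hw j).le) (Finset.mem_range.2 hi)).trans hfE
    rw [div_le_iff₀' (hw i)] at h1
    exact lt_of_pow_lt_pow_left₀ 2 hε.le (h1.trans_lt (hE i))
  have hstep : ∀ i, i + 1 < k → (w i)⁻¹ • f i = (w (i + 1))⁻¹ • f (i + 1) := by
    intro i hi
    -- Varying along the discrepancy itself makes the first variation `-2 * τ (X * X)`, so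
    -- criticality forces `X = 0`.
    set X : L := (w i)⁻¹ • f i - (w (i + 1))⁻¹ • f (i + 1) with hX
    obtain ⟨c, v, hc0, hcd, hcv, hce⟩ := hcurve (f i) (hlt i (by omega)) X
    -- Starting at `-f (i + 1)` turns right translation into left translation after inversion: `exp
    -- (-c' s) = exp (-(s • X)) * exp (f (i + 1))`.
    obtain ⟨c', v', hc0', hcd', hcv', hce'⟩ :=
      hcurve (-f (i + 1)) (by simpa using hlt (i + 1) hi) X
    let g : ℝ → ℕ → L := fun s => Function.update (Function.update f i (c s)) (i + 1) (-c' s)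
    have hgi : ∀ s, g s i = c s := fun s => by simp [g]
    have hgi' : ∀ s, g s (i + 1) = -c' s := fun s => by simp [g]
    have hgj : ∀ s j, j ≠ i → j ≠ i + 1 → g s j = f j := fun s j h1 h2 => by simp [g, h1, h2]
    have hnorm : ∀ᶠ s in 𝓝 (0 : ℝ), ‖c s‖ < ε ∧ ‖c' s‖ < ε :=
      (hcd.continuousAt.norm.eventually_lt_const (by simp only [hc0]; exact hlt i (by omega))).and
        (hcd'.continuousAt.norm.eventually_lt_const
          (by simp only [hc0', norm_neg]; exact hlt (i + 1) hi))
    let h : ℝ → ℝ := fun s => ‖c s‖ ^ 2 / w i + ‖c' s‖ ^ 2 / w (i + 1)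
    have hhE : ∀ s, ∑ j ∈ Finset.range k, ‖g s j‖ ^ 2 / w j =
        h s + ∑ j ∈ ((Finset.range k).erase i).erase (i + 1), ‖f j‖ ^ 2 / w j := fun s => by
      rw [← Finset.add_sum_erase _ _ (Finset.mem_range.2 (show i < k by omega)),
        ← Finset.add_sum_erase _ _ (Finset.mem_erase.2 ⟨Nat.succ_ne_self i, Finset.mem_range.2 hi⟩),
        ← add_assoc, hgi, hgi', norm_neg]
      congr 1
      refine Finset.sum_congr rfl fun j hj => ?_
      simp only [Finset.mem_erase] at hj
      rw [hgj s j hj.2.1 hj.1]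
    have hg0 : g 0 = f := by simp [g, hc0, hc0']
    have hloc : IsLocalMin h 0 := by
      filter_upwards [hnorm, hce, hce'] with s hs hes hes'
      have := hmin (g s) (fun j => ?_) ?_
      · rw [← hg0, hhE, hhE] at this
        linarith
      · rcases eq_or_ne j i with rfl | h1
        · rw [hgi]; exact hs.1.le
        · rcases eq_or_ne j (i + 1) with rfl | h2
          · rw [hgi', norm_neg]; exact hs.2.le
          · rw [hgj s j h1 h2]; exact hf j
      · rw [← hfp]
        refine expProd_eq_of_pair hi (fun j h1 h2 => by rw [hgj s j h1 h2]) ?_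
        rw [hgi, hgi', hes]
        have hinv : exp (-(c' s : 𝔸)) = exp (-(s • (X : 𝔸))) * exp (f (i + 1) : 𝔸) := by
          have h1 : exp (c' s : 𝔸) * (exp (-(s • (X : 𝔸))) * exp (f (i + 1) : 𝔸)) = 1 := by
            rw [hes', Submodule.coe_neg, mul_assoc, ← mul_assoc (exp (s • (X : 𝔸))),
              exp_mul_exp_neg_self, one_mul, exp_neg_mul_exp_self]
          exact left_inv_eq_right_inv (exp_neg_mul_exp_self _) h1
        rw [Submodule.coe_neg, hinv, mul_assoc, ← mul_assoc (exp (s • (X : 𝔸))),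
          exp_mul_exp_neg_self, one_mul]
    have hd : HasDerivAt h (-2 * τ (c 0 * v) / w i + -2 * τ (c' 0 * v') / w (i + 1)) 0 :=
      ((hasDerivAt_norm_sq_of_traceForm hτ hn hcd).div_const _).add
        ((hasDerivAt_norm_sq_of_traceForm hτ hn hcd').div_const _)
    have hzero := hloc.hasDerivAt_eq_zero hd
    rw [hc0, hc0', traceForm_mul_eq_of_exp_neg_mul_fderiv_exp_eq hτ hcv,
      traceForm_mul_eq_of_exp_neg_mul_fderiv_exp_eq hτ hcv'] at hzero
    have hXX : τ ((X : 𝔸) * X) = 0 := by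
      have : τ ((X : 𝔸) * X) =
          (w i)⁻¹ * τ (f i * X) - (w (i + 1))⁻¹ * τ (f (i + 1) * X) := by
        conv_lhs => rw [show (X : 𝔸) * X =
          (w i)⁻¹ • ((f i : 𝔸) * X) - (w (i + 1))⁻¹ • ((f (i + 1) : 𝔸) * X) by
            conv_lhs => enter [1]; rw [hX]
            simp [sub_mul]]
        simp
      rw [this]
      simp only [Submodule.coe_neg, neg_mul, map_neg] at hzero
      linear_combination (-1 / 2) * hzero
    have hX0 : X = 0 := by
      have := hn X X.2
      rw [hXX, neg_zero, sq_eq_zero_iff, norm_eq_zero] at this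
      exact Subtype.ext this
    exact sub_eq_zero.1 hX0
  have hall : ∀ i < k, f i = w i • ((w 0)⁻¹ • f 0) := fun i hi => by
    have : (w i)⁻¹ • f i = (w 0)⁻¹ • f 0 := by
      induction i with
      | zero => rfl
      | succ i ih => rw [← hstep i hi, ih (by omega)]
    rw [← this, smul_inv_smul₀ (hw i).ne']
  generalize (w 0)⁻¹ • f 0 = C at hall
  refine ⟨C, ?_, ?_⟩
  · rw [← hfp, expProd_smul (w := w) (C := (C : 𝔸))]
    intro i hi
    rw [hall i hi]
    rfl
  · refine le_trans (le_of_eq ?_) hfE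
    rw [Finset.sum_mul]
    refine Finset.sum_congr rfl fun i hi => ?_
    have := (hw i).ne'
    rw [hall i (Finset.mem_range.1 hi), norm_smul, Real.norm_eq_abs, mul_pow, sq_abs]
    field_simp

end Minimization

/-! ### The triangle inequality for logarithms. -/

section TwoFactors

open NormedSpace

variable {𝔸 : Type*} [NormedRing 𝔸] [NormedAlgebra ℝ 𝔸]

theorem expProd_ite_smul [CompleteSpace 𝔸] (a b : 𝔸) (r : ℝ) (m k : ℕ) :
    expProd (fun i => if i < m then r • a else r • b) (m + k) =
      exp ((m * r) • a) * exp ((k * r) • b) := by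
  induction k with
  | zero =>
    rw [add_zero, expProd_smul (w := fun _ => r) (C := a) (fun i hi => by simp [hi])]
    simp
  | succ k ih =>
    rw [← add_assoc, expProd, ih, if_neg (by omega), mul_assoc, exp_smul_mul_exp_smul]
    push_cast
    ring_nf

/-- In a Lie algebra whose norm comes from an invariant trace form, a product of two exponentials
is an exponential whose logarithm satisfies the triangle inequality. -/
theorem exists_exp_eq_exp_mul_exp_norm_le [FiniteDimensional ℝ 𝔸] {L : Submodule ℝ 𝔸}
    (hL : ∀ x ∈ L, ∀ y ∈ L, x * y - y * x ∈ L) {τ : 𝔸 →L[ℝ] ℝ}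
    (hτ : ∀ x y, τ (x * y) = τ (y * x)) (hn : ∀ x ∈ L, ‖x‖ ^ 2 = -τ (x * x))
    {a b : 𝔸} (ha : a ∈ L) (hb : b ∈ L) :
    ∃ c ∈ L, exp c = exp a * exp b ∧ ‖c‖ ≤ ‖a‖ + ‖b‖ := by
  have := FiniteDimensional.complete ℝ 𝔸
  rcases eq_or_ne a 0 with rfl | ha0
  · exact ⟨b, hb, by simp, by simp⟩
  rcases eq_or_ne b 0 with rfl | hb0
  · exact ⟨a, ha, by simp, by simp⟩
  have hap := norm_pos_iff.2 ha0
  have hbp := norm_pos_iff.2 hb0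
  obtain ⟨ε, hε, H⟩ := exists_exp_eq_expProd hL hτ hn
  set ℓ := ‖a‖ + ‖b‖ with hℓ
  have hℓp : 0 < ℓ := by positivity
  -- This one bound yields both smallness conditions, `‖f i‖ ≤ ε` and `w i * ℓ < ε ^ 2`.
  obtain ⟨m, hm⟩ := exists_nat_gt (ℓ ^ 2 / ε ^ 2)
  have hmp : (0 : ℝ) < m := lt_of_le_of_lt (by positivity) hm
  have hsmall : ℓ ^ 2 / m < ε ^ 2 := by
    rw [div_lt_iff₀ (by positivity)] at hm ⊢
    linarith
  let f : ℕ → L := fun i => if i < m then (m : ℝ)⁻¹ • ⟨a, ha⟩ else (m : ℝ)⁻¹ • ⟨b, hb⟩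
  -- With `w i = ‖f i‖` (unit speed), the total weight and the initial energy both equal `ℓ`; the
  -- minimization then gives `ℓ * ‖C‖ ^ 2 ≤ ℓ`.
  let w : ℕ → ℝ := fun i => if i < m then ‖a‖ / m else ‖b‖ / m
  have hw : ∀ i, 0 < w i := fun i => by simp only [w]; split_ifs <;> positivity
  have hfw : ∀ i, ‖f i‖ = w i := fun i => by
    simp only [f, w]
    split_ifs <;> simp [norm_smul, div_eq_inv_mul]
  have hwle : ∀ i, w i ≤ ℓ / m := fun i => by
    simp only [w, hℓ]
    split_ifs <;> gcongr <;> linarith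
  have hsumw : ∑ i ∈ Finset.range (m + m), w i = ℓ := by
    rw [Finset.sum_range_add, Finset.sum_congr rfl (g := fun _ => ‖a‖ / m)
      (fun i hi => by simp [w, Finset.mem_range.1 hi]), Finset.sum_congr (s₁ := Finset.range m) rfl
      (f := fun i => w (m + i)) (g := fun _ => ‖b‖ / m) (fun i hi => by simp [w])]
    simp only [Finset.sum_const, Finset.card_range, nsmul_eq_mul]
    field_simp
    exact hℓ.symm
  have hE : ∑ i ∈ Finset.range (m + m), ‖f i‖ ^ 2 / w i = ℓ := by
    rw [← hsumw]
    refine Finset.sum_congr rfl fun i _ => ?_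
    have := (hw i).ne'
    rw [hfw]
    field_simp
  have hfε : ∀ i, ‖f i‖ ≤ ε := fun i => by
    rw [hfw]
    refine le_of_pow_le_pow_left₀ two_ne_zero hε.le ?_
    have hm1 : (1 : ℝ) ≤ m := by exact_mod_cast hmp
    calc w i ^ 2 ≤ (ℓ / m) ^ 2 := pow_le_pow_left₀ (hw i).le (hwle i) 2
      _ = ℓ ^ 2 / m / m := by ring
      _ ≤ ℓ ^ 2 / m := div_le_self (by positivity) hm1
      _ ≤ ε ^ 2 := hsmall.le
  have hwε : ∀ i, w i * ∑ j ∈ Finset.range (m + m), ‖f j‖ ^ 2 / w j < ε ^ 2 := fun i => by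
    rw [hE]
    calc w i * ℓ ≤ ℓ / m * ℓ := by gcongr; exact hwle i
      _ = ℓ ^ 2 / m := by ring
      _ < ε ^ 2 := hsmall
  obtain ⟨C, hC, hCn⟩ := H (m + m) w f hw hfε hwε
  rw [hsumw] at hC hCn
  rw [hE] at hCn
  have hC1 : ‖C‖ ≤ 1 := by
    have h1 : ‖C‖ ^ 2 ≤ 1 := le_of_mul_le_mul_left (by simpa using hCn) hℓp
    nlinarith [norm_nonneg C]
  refine ⟨ℓ • (C : 𝔸), L.smul_mem _ C.2, ?_, ?_⟩
  · have hfe : (fun i => (f i : 𝔸)) =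
        fun i => if i < m then (m : ℝ)⁻¹ • a else (m : ℝ)⁻¹ • b := by
      funext i
      simp only [f]
      split_ifs <;> rfl
    rw [hC, hfe, expProd_ite_smul, mul_inv_cancel₀ hmp.ne', one_smul, one_smul]
  · rw [norm_smul, Real.norm_of_nonneg hℓp.le]
    exact mul_le_of_le_one_right hℓp.le hC1

end TwoFactors

/-! ### Anti-Hermitian matrices and the metric. -/

section MatrixLieAlgebra

open NormedSpace

attribute [local instance] Matrix.frobeniusNormedRing Matrix.frobeniusNormedAlgebra

namespace UnitaryMetric

variable {n : Type*} [Fintype n] [DecidableEq n]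

theorem re_trace_conjTranspose_mul_self (A : Matrix n n ℂ) :
    (Matrix.trace (A.conjTranspose * A)).re = ‖A‖ ^ 2 := by
  have h0 : 0 ≤ ∑ i, ∑ j, ‖A i j‖ ^ 2 := by positivity
  have h : ‖A‖ ^ 2 = ∑ i, ∑ j, ‖A i j‖ ^ 2 := by
    simp only [Matrix.frobenius_norm_def, ← Real.sqrt_eq_rpow, Real.rpow_two]
    exact Real.sq_sqrt h0
  rw [h, Finset.sum_comm]
  simp only [Matrix.trace, Matrix.diag_apply, Matrix.mul_apply, Matrix.conjTranspose_apply,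
    Complex.re_sum]
  refine Finset.sum_congr rfl fun i _ => Finset.sum_congr rfl fun j _ => ?_
  rw [← Complex.normSq_eq_norm_sq, Complex.normSq_apply]
  simp

theorem frobNorm_eq_norm (A : Matrix n n ℂ) : frobNorm A = ‖A‖ := by
  rw [frobNorm, re_trace_conjTranspose_mul_self, Real.sqrt_sq (norm_nonneg A)]

/-- The real part of the trace as a continuous linear functional. -/
noncomputable def reTrace (n : Type*) [Fintype n] : Matrix n n ℂ →L[ℝ] ℝ :=
  LinearMap.toContinuousLinearMap (Complex.reLm ∘ₗ Matrix.traceLinearMap n ℝ ℂ)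

/-- The invariant form is the real part of the trace; for anti-Hermitian `x`, `tr (x† x) = -tr (x
x)`. -/
theorem exists_exp_eq_exp_mul_exp_frobNorm_le {L : LieSubalgebra ℝ (Matrix n n ℂ)}
    (hL : ∀ C ∈ L, C.conjTranspose = -C) {A B : Matrix n n ℂ} (hA : A ∈ L) (hB : B ∈ L) :
    ∃ C ∈ L, exp C = exp A * exp B ∧ frobNorm C ≤ frobNorm A + frobNorm B := by
  simp only [frobNorm_eq_norm]
  refine exists_exp_eq_exp_mul_exp_norm_le (L := L.toSubmodule) (τ := reTrace n)
    (fun x hx y hy => L.lie_mem hx hy)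
    (fun x y => congrArg Complex.re (Matrix.trace_mul_comm x y)) (fun x hx => ?_) hA hB
  change ‖x‖ ^ 2 = -(Matrix.trace (x * x)).re
  rw [← re_trace_conjTranspose_mul_self, hL x hx]
  simp

theorem exists_exp_eq_mul_inv {L : LieSubalgebra ℝ (Matrix n n ℂ)}
    (hL : ∀ C ∈ L, C.conjTranspose = -C) {U₁ U₂ : Matrix.unitaryGroup n ℂ}
    (h₁ : U₁ ∈ expSet L) (h₂ : U₂ ∈ expSet L) :
    ∃ C ∈ L, exp C = ((U₁ * U₂⁻¹ : Matrix.unitaryGroup n ℂ) : Matrix n n ℂ) := by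
  obtain ⟨A, hA, hAU⟩ := h₁
  obtain ⟨B, hB, hBU⟩ := h₂
  obtain ⟨C, hC, hCe, -⟩ := exists_exp_eq_exp_mul_exp_frobNorm_le hL hA (L.neg_mem hB)
  refine ⟨C, hC, ?_⟩
  rw [hCe, hAU, ← hL B hB, Matrix.exp_conjTranspose, hBU]
  rfl

theorem isLeast_unitaryDist {L : LieSubalgebra ℝ (Matrix n n ℂ)}
    (hL : ∀ C ∈ L, C.conjTranspose = -C) {U₁ U₂ : Matrix.unitaryGroup n ℂ}
    (h₁ : U₁ ∈ expSet L) (h₂ : U₂ ∈ expSet L) :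
    IsLeast (generatorNorms L U₁ U₂) (unitaryDist L U₁ U₂) := by
  have : ProperSpace (Matrix n n ℂ) := FiniteDimensional.proper ℝ _
  let S : Set (Matrix n n ℂ) := {C | C ∈ L.toSubmodule} ∩
    {C | exp C = ((U₁ * U₂⁻¹ : Matrix.unitaryGroup n ℂ) : Matrix n n ℂ)}
  have hS : IsClosed S := L.toSubmodule.closed_of_finiteDimensional.inter
    (isClosed_eq continuous_exp_real continuous_const)
  obtain ⟨C₀, hC₀, hC₀e⟩ := exists_exp_eq_mul_inv hL h₁ h₂
  -- A shortest logarithm is a point of `S` nearest to `0`.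
  obtain ⟨C, ⟨hC, hCe⟩, hCd⟩ := hS.exists_infDist_eq_dist ⟨C₀, hC₀, hC₀e⟩ 0
  have hleast : IsLeast (generatorNorms L U₁ U₂) (frobNorm C) := by
    refine ⟨⟨C, hC, hCe, rfl⟩, ?_⟩
    rintro _ ⟨B, hB, hBe, rfl⟩
    have := Metric.infDist_le_dist_of_mem (x := 0) (show B ∈ S from ⟨hB, hBe⟩)
    rw [hCd, dist_zero_left, dist_zero_left] at this
    simpa only [frobNorm_eq_norm] using this
  rw [unitaryDist, hleast.csInf_eq]
  exact hleast

theorem unitaryDist_nonneg (L : LieSubalgebra ℝ (Matrix n n ℂ)) (U₁ U₂ : Matrix.unitaryGroup n ℂ) :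
    0 ≤ unitaryDist L U₁ U₂ :=
  Real.sInf_nonneg fun _ ⟨_, _, _, h⟩ => h ▸ Real.sqrt_nonneg _

theorem unitaryDist_eq_zero_iff {L : LieSubalgebra ℝ (Matrix n n ℂ)}
    (hL : ∀ C ∈ L, C.conjTranspose = -C) {U₁ U₂ : Matrix.unitaryGroup n ℂ}
    (h₁ : U₁ ∈ expSet L) (h₂ : U₂ ∈ expSet L) : unitaryDist L U₁ U₂ = 0 ↔ U₁ = U₂ := by
  constructor
  · intro h
    obtain ⟨C, hC, hCe, hCn⟩ := (isLeast_unitaryDist hL h₁ h₂).1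
    rw [h, frobNorm_eq_norm, norm_eq_zero] at hCn
    rw [hCn, exp_zero] at hCe
    exact mul_inv_eq_one.1 (Subtype.ext hCe.symm)
  · rintro rfl
    refine le_antisymm ((isLeast_unitaryDist hL h₁ h₂).2 ⟨0, L.zero_mem, ?_, ?_⟩)
      (unitaryDist_nonneg L U₁ U₁)
    · simp
    · rw [frobNorm_eq_norm, norm_zero]

theorem generatorNorms_subset_swap {L : LieSubalgebra ℝ (Matrix n n ℂ)}
    (hL : ∀ C ∈ L, C.conjTranspose = -C) (U₁ U₂ : Matrix.unitaryGroup n ℂ) :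
    generatorNorms L U₁ U₂ ⊆ generatorNorms L U₂ U₁ := by
  rintro _ ⟨C, hC, hCe, rfl⟩
  refine ⟨-C, L.neg_mem hC, ?_, ?_⟩
  · rw [← hL C hC, Matrix.exp_conjTranspose, hCe, show U₂ * U₁⁻¹ = (U₁ * U₂⁻¹)⁻¹ by group]
    rfl
  · rw [frobNorm_eq_norm, frobNorm_eq_norm, norm_neg]

theorem unitaryDist_comm {L : LieSubalgebra ℝ (Matrix n n ℂ)}
    (hL : ∀ C ∈ L, C.conjTranspose = -C) (U₁ U₂ : Matrix.unitaryGroup n ℂ) :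
    unitaryDist L U₁ U₂ = unitaryDist L U₂ U₁ :=
  congrArg sInf ((generatorNorms_subset_swap hL U₁ U₂).antisymm
    (generatorNorms_subset_swap hL U₂ U₁))

theorem unitaryDist_triangle {L : LieSubalgebra ℝ (Matrix n n ℂ)}
    (hL : ∀ C ∈ L, C.conjTranspose = -C) {U₁ U₂ U₃ : Matrix.unitaryGroup n ℂ}
    (h₁ : U₁ ∈ expSet L) (h₂ : U₂ ∈ expSet L) (h₃ : U₃ ∈ expSet L) :
    unitaryDist L U₁ U₂ ≤ unitaryDist L U₁ U₃ + unitaryDist L U₃ U₂ := by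
  obtain ⟨A, hA, hAe, hAn⟩ := (isLeast_unitaryDist hL h₁ h₃).1
  obtain ⟨B, hB, hBe, hBn⟩ := (isLeast_unitaryDist hL h₃ h₂).1
  obtain ⟨C, hC, hCe, hCn⟩ := exists_exp_eq_exp_mul_exp_frobNorm_le hL hA hB
  rw [hAn, hBn] at hCn
  refine ((isLeast_unitaryDist hL h₁ h₂).2 ⟨C, hC, ?_, rfl⟩).trans hCn
  rw [hCe, hAe, hBe, ← Submonoid.coe_mul]
  congr 1
  group

end UnitaryMetric

end MatrixLieAlgebra

theorem mainTheorem4 {n : Type*} [Fintype n] [DecidableEq n]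
    (L : LieSubalgebra ℝ (Matrix n n ℂ))
    (hL : ∀ C ∈ L, C.conjTranspose = -C) :
    -- the minimum defining `d` exists
    (∀ U₁ ∈ UnitaryMetric.expSet L, ∀ U₂ ∈ UnitaryMetric.expSet L,
      IsLeast (UnitaryMetric.generatorNorms L U₁ U₂) (UnitaryMetric.unitaryDist L U₁ U₂)) ∧
    -- (i)
    (∀ U₁ ∈ UnitaryMetric.expSet L, ∀ U₂ ∈ UnitaryMetric.expSet L,
      (UnitaryMetric.unitaryDist L U₁ U₂ = 0 ↔ U₁ = U₂)) ∧
    -- (ii)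
    (∀ U₁ ∈ UnitaryMetric.expSet L, ∀ U₂ ∈ UnitaryMetric.expSet L,
      U₁ ≠ U₂ → 0 < UnitaryMetric.unitaryDist L U₁ U₂) ∧
    -- (iii)
    (∀ U₁ ∈ UnitaryMetric.expSet L, ∀ U₂ ∈ UnitaryMetric.expSet L,
      UnitaryMetric.unitaryDist L U₁ U₂ = UnitaryMetric.unitaryDist L U₂ U₁) ∧
    -- (iv)
    (∀ U₁ ∈ UnitaryMetric.expSet L, ∀ U₂ ∈ UnitaryMetric.expSet L,
      ∀ U₃ ∈ UnitaryMetric.expSet L,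
      UnitaryMetric.unitaryDist L U₁ U₂ ≤
        UnitaryMetric.unitaryDist L U₁ U₃ + UnitaryMetric.unitaryDist L U₃ U₂) :=
  ⟨fun _ h₁ _ h₂ => UnitaryMetric.isLeast_unitaryDist hL h₁ h₂,
    fun _ h₁ _ h₂ => UnitaryMetric.unitaryDist_eq_zero_iff hL h₁ h₂,
    fun _ h₁ _ h₂ hne => (UnitaryMetric.unitaryDist_nonneg L _ _).lt_of_ne' fun h =>
      hne ((UnitaryMetric.unitaryDist_eq_zero_iff hL h₁ h₂).1 h),
    fun U₁ _ U₂ _ => UnitaryMetric.unitaryDist_comm hL U₁ U₂,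
    fun _ h₁ _ h₂ _ h₃ => UnitaryMetric.unitaryDist_triangle hL h₁ h₂ h₃⟩
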